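/- Setting. Let $\mathcal I$ be a finite index set. A recursive structural causal model (SCM) $\mathcal M$ consists of measurable spaces $\Omega_{V_i},\Omega_{U_i}$ ($i\in\mathcal I$), parent sets $\mathrm{pa}(i)\subseteq\mathcal I$, jointly measurable mechanisms $f_i:\Omega_{\mathbf V_{\mathrm{pa}(i)}}\times\Omega_{U_i}\to\Omega_{V_i}$ (we write $f_i(\mathbf v,u_i)=f_i(\mathbf v_{\mathrm{pa}(i)},u_i)$ for $\mathbf v\in\Omega_{\mathbf V}=\prod_i\Omega_{V_i}$), and a probability measure $P_{\mathbf U}$ on $\Omega_{\mathbf U}=\prod_i\Omega_{U_i}$, such that there is a causal order, i.e. a total order $\le$ on $\mathcal I$ with $j<i$ whenever $j\in\mathrm{pa}(i)$. Its solution mapping $\mathbf\Gamma:\Omega_{\mathbf U}\to\Omega_{\mathbf V}$ is the unique map with $\mathbf\Gamma(\mathbf u)_i=f_i(\mathbf\Gamma(\mathbf u),u_i)$, and its observed distribution is $P_{\mathbf V}=\mathbf\Gamma_\sharp P_{\mathbf U}$. It is Markovian if the exogenous variables $U_i$ are mutually independent. A map $\mathbf T:\mathbb R^n\to\mathbb R^n$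 is a triangular monotonic (TM) mapping if $T_j$ depends only on $x_1,\dots,x_j$ and, for each $j$, the maps $x_j\mapsto T_j(x_1,\dots,x_{j-1},x_j)$ are bijections $\mathbb R\to\mathbb R$ that are strictly increasing for all $x_1,\dots,x_{j-1}$, or strictly decreasing for all $x_1,\dots,x_{j-1}$. Let $\Omega_{V_i}=\Omega_{U_i}=\mathbb R^{d_i}$ and $D=\sum_i d_i$. The vectorization of a total order $\le$ on $\mathcal I$ is the bijection $\iota:\{(i,j):i\in\mathcal I,\,1\le j\le d_i\}\to\{1,\dots,D\}$ with $\iota(i,j)-\iota(i,j')=j-j'$, and $\iota(i,j)<\iota(i',j')$ whenever $i<i'$. The SCM $\mathcal M$ is a TM-SCM if for some causal order of $\mathcal M$ with vectorization $\iota$ the solution mapping, written in the coordinates of $\mathbb R^D$ given by $\iota$, is a TM mapping. Two recursive SCMs $\mathcal M^{(1)},\mathcal M^{(2)}$ with the same $\mathcal I$ and $\Omega_{\mathbf V}$ are exogenously isomorphic, $\mathcal M^{(1)}\sim_{\mathrm{EI}}\mathcal M^{(2)}$, if they have a common causal order and there are bimeasurable bijections $h_i:\Omega^{(1)}_{U_i}\to\Omega^{(2)}_{U_i}$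 such that $\mathbf h=(h_i)_{i}$ satisfies $\mathbf h_\sharp P^{(1)}_{\mathbf U}=P^{(2)}_{\mathbf U}$ and, for every $i\in\mathcal I$, $$f^{(2)}_i(\mathbf v,h_i(u_i))=f^{(1)}_i(\mathbf v,u_i)$$ for $P^{(1)}_{\mathbf U}$-almost every $\mathbf u$ and $P^{(1)}_{\mathbf V}$-almost every $\mathbf v$. They are exogenously isomorphic everywhere if $h$ can be chosen so that the last equation holds for $P^{(1)}_{\mathbf U}$-almost every $\mathbf u$ and all $\mathbf v\in\Omega_{\mathbf V}$. Theorem. Let $\le$ be a total order on $\mathcal I$ and $P_{\mathbf V}$ a distribution on $\prod_i\mathbb R^{d_i}$. The class of Markovian TM-SCMs with $\Omega_{V_i}=\Omega_{U_i}=\mathbb R^{d_i}$ that induce the causal order $\le$ and the observed distribution $P_{\mathbf V}$ is $\sim_{\mathrm{EI}}$-identifiable: any two SCMs $\mathcal M^{(1)},\mathcal M^{(2)}$ of this class satisfy $\mathcal M^{(1)}\sim_{\mathrm{EI}}\mathcal M^{(2)}$. Moreover, if $P_{\mathbf V}$ gives positive mass to every nonempty open set, then any two SCMs of this class whose mechanisms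 $f_i(\mathbf v,u_i)$ are continuous in $\mathbf v$ are exogenously isomorphic everywhere. -/

import Mathlib

open MeasureTheory ProbabilityTheory

/-- A recursive structural causal model with finitely many endogenous variables `v i`, each with
its exogenous variable `u i`, its set of parents, and a measurable mechanism
`v i = f i (v restricted to pa i) (u i)`.  Recursive: some total order puts every parent of `i`
strictly before `i`. -/
structure SCM (I : Type*) (V U : I → Type*)
    [∀ i, MeasurableSpace (V i)] [∀ i, MeasurableSpace (U i)] where
  pa : I → Set I
  f : ∀ i, (∀ j : pa i, V j) → U i → V i
  measurable_f : ∀ i, Measurable (fun p : (∀ j : pa i, V j) × U i => f i p.1 p.2)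
  PU : Measure (∀ i, U i)
  isProbabilityMeasure_PU : IsProbabilityMeasure PU
  recursive : ∃ o : LinearOrder I, ∀ i, ∀ j ∈ pa i, o.lt j i

namespace SCM

section General

variable {I : Type*} {V U U' : I → Type*} [∀ i, MeasurableSpace (V i)]
  [∀ i, MeasurableSpace (U i)] [∀ i, MeasurableSpace (U' i)]

/-- The total order `o` on the variables is a causal order induced by `M`. -/
def IsCausalOrder (M : SCM I V U) (o : LinearOrder I) : Prop :=
  ∀ i, ∀ j ∈ M.pa i, o.lt j i

/-- The mechanism `f i (v, u)`, as a function of the whole endogenous vector `v`. -/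
def mech (M : SCM I V U) (i : I) (v : ∀ i, V i) (u : U i) : V i :=
  M.f i (fun j => v j) u

theorem wellFounded_pa [Finite I] (M : SCM I V U) : WellFounded (fun j i => j ∈ M.pa i) := by
  obtain ⟨o, ho⟩ := M.recursive
  have hw : WellFounded (fun j i : I => o.lt j i) :=
    (Finite.to_wellFoundedLT (α := I)).wf
  exact Subrelation.wf (fun {j i} h => ho i j h) hw

/-- The solution mapping `Γ`: the endogenous vector obtained by solving
`v i = f i (v, u i)` recursively along the parent relation. -/
noncomputable def solution [Finite I] (M : SCM I V U) (u : ∀ i, U i) (i : I) : V i :=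
  M.wellFounded_pa.fix (C := fun i => V i) (fun i rec => M.f i (fun j => rec j.1 j.2) (u i)) i

theorem solution_eq [Finite I] (M : SCM I V U) (u : ∀ i, U i) (i : I) :
    M.solution u i = M.mech i (M.solution u) (u i) := by
  unfold solution
  rw [WellFounded.fix_eq]
  rfl

theorem measurable_solution [Finite I] (M : SCM I V U) : Measurable M.solution := by
  refine measurable_pi_lambda _ fun i => ?_
  induction i using M.wellFounded_pa.induction with
  | _ i ih =>
    have h1 : Measurable (fun u : ∀ i, U i => fun j : M.pa i => M.solution u j) :=
      measurable_pi_lambda _ fun j => ih j.1 j.2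
    have h2 := (M.measurable_f i).comp (h1.prodMk (measurable_pi_apply i))
    have h3 : (fun u => M.solution u i)
        = (fun p : (∀ j : M.pa i, V j) × U i => M.f i p.1 p.2) ∘
          (fun u : ∀ i, U i => ((fun j : M.pa i => M.solution u j), u i)) := by
      funext u
      exact M.solution_eq u i
    rw [h3]
    exact h2

/-- The observed distribution `P_V`, the law of the endogenous variables. -/
noncomputable def observed [Finite I] (M : SCM I V U) : Measure (∀ i, V i) :=
  M.PU.map M.solution

/-- Markovian: the exogenous variables are mutually independent. -/
def IsMarkovian (M : SCM I V U) : Prop :=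
  iIndepFun (fun (i : I) (u : ∀ i, U i) => u i) M.PU

/-- Exogenous isomorphism: a common causal order and a component-wise bimeasurable bijection of
the exogenous spaces which carries one exogenous distribution to the other and matches the
mechanisms, for almost every exogenous `u` and `P_V`-almost every `v`. -/
def EIEquiv [Finite I] (M₁ : SCM I V U) (M₂ : SCM I V U') : Prop :=
  (∃ o : LinearOrder I, M₁.IsCausalOrder o ∧ M₂.IsCausalOrder o) ∧
  ∃ h : ∀ i, U i ≃ᵐ U' i,
    M₁.PU.map (fun u i => h i (u i)) = M₂.PU ∧
    ∀ i, ∀ᵐ u ∂M₁.PU, ∀ᵐ v ∂M₁.observed, M₂.mech i v (h i (u i)) = M₁.mech i v (u i)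

/-- Exogenous isomorphism with the mechanisms matched at every `v` without exception. -/
def EIEquivEverywhere (M₁ : SCM I V U) (M₂ : SCM I V U') : Prop :=
  (∃ o : LinearOrder I, M₁.IsCausalOrder o ∧ M₂.IsCausalOrder o) ∧
  ∃ h : ∀ i, U i ≃ᵐ U' i,
    M₁.PU.map (fun u i => h i (u i)) = M₂.PU ∧
    ∀ i, ∀ᵐ u ∂M₁.PU, ∀ v, M₂.mech i v (h i (u i)) = M₁.mech i v (u i)

/-- A class `A` of models is identifiable up to the relation `R`. -/
def Identifiable (A : Set (SCM I V U)) (R : SCM I V U → SCM I V U → Prop) : Prop :=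
  ∀ M₁ ∈ A, ∀ M₂ ∈ A, R M₁ M₂

end General

end SCM

/-- `T : ℝⁿ → ℝⁿ` is triangular: its `j`-th component depends on the first `j` coordinates only. -/
def IsTriangular {n : ℕ} (T : (Fin n → ℝ) → (Fin n → ℝ)) : Prop :=
  ∀ j x y, (∀ k ≤ j, x k = y k) → T x j = T y j

/-- Triangular monotonic mapping: triangular, and for each `j` the section
`x_j ↦ T_j (x_1, …, x_{j-1}, x_j)` is an invertible map `ℝ → ℝ`, either strictly increasing for
all `x_1, …, x_{j-1}` or strictly decreasing for all of them. -/
def IsTMMapping {n : ℕ} (T : (Fin n → ℝ) → (Fin n → ℝ)) : Prop :=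
  IsTriangular T ∧
  ∀ j, ((∀ x, StrictMono fun t => T (Function.update x j t) j) ∨
        (∀ x, StrictAnti fun t => T (Function.update x j t) j)) ∧
    ∀ x, Function.Surjective fun t => T (Function.update x j t) j

/-- `ι` is the vectorization of the block index set `{(i, j) | j < d i}` under the order `o`:
it keeps the spacing inside each block and puts the blocks in the order `o`. -/
def IsVectorization {I : Type*} [Fintype I] {d : I → ℕ} (o : LinearOrder I)
    (ι : (Σ i, Fin (d i)) ≃ Fin (∑ i, d i)) : Prop :=
  (∀ i (j j' : Fin (d i)), ((ι ⟨i, j⟩ : ℕ) : ℤ) - ((ι ⟨i, j'⟩ : ℕ) : ℤ)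
      = ((j : ℕ) : ℤ) - ((j' : ℕ) : ℤ)) ∧
  ∀ i i' (j : Fin (d i)) (j' : Fin (d i')), o.lt i i' → ι ⟨i, j⟩ < ι ⟨i', j'⟩

/-- The reindexing bijection `∏ i, ℝ^(d i) ≃ ℝ^D`, `D = ∑ i, d i`, given by `ι`. -/
def reindex {I : Type*} [Fintype I] {d : I → ℕ} (ι : (Σ i, Fin (d i)) ≃ Fin (∑ i, d i)) :
    (∀ i, Fin (d i) → ℝ) ≃ (Fin (∑ i, d i) → ℝ) where
  toFun x k := x (ι.symm k).1 (ι.symm k).2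
  invFun y i j := y (ι ⟨i, j⟩)
  left_inv x := by
    funext i j
    exact congrArg (fun p : Σ i, Fin (d i) => x p.1 p.2) (ι.symm_apply_apply ⟨i, j⟩)
  right_inv y := by
    funext k
    simp

/-- The models with `V i = U i = ℝ^(d i)`. -/
abbrev RealSCM {I : Type*} (d : I → ℕ) :=
  SCM I (fun i => Fin (d i) → ℝ) (fun i => Fin (d i) → ℝ)

namespace SCM

variable {I : Type*} [Fintype I] {d : I → ℕ}

/-- Triangular monotonic SCM: for some causal order with its vectorization, the solution mapping,
written in the coordinates of `ℝ^D`, is a triangular monotonic mapping. -/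
def IsTMSCM (M : RealSCM d) : Prop :=
  ∃ o : LinearOrder I, M.IsCausalOrder o ∧
    ∃ ι : (Σ i, Fin (d i)) ≃ Fin (∑ i, d i), IsVectorization o ι ∧
      IsTMMapping (fun x => reindex ι (M.solution ((reindex ι).symm x)))

/-- The class of Markovian TM-SCMs inducing the causal order `o`, with observed distribution
`PV`. -/
def markovTMClass (d : I → ℕ) (o : LinearOrder I) (PV : Measure (∀ i, Fin (d i) → ℝ)) :
    Set (RealSCM d) :=
  {M | M.IsTMSCM ∧ M.IsCausalOrder o ∧ M.IsMarkovian ∧ M.observed = PV}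

/-- All mechanisms are continuous in the endogenous argument. -/
def ContinuousInEndogenous (M : RealSCM d) : Prop :=
  ∀ i (u : Fin (d i) → ℝ), Continuous fun v => M.mech i v u

end SCM

/-!
The mechanism `f i (v, ·)` of a triangular monotonic model is, for every `v`, a triangular
bijection of `ℝ^(d i)` whose sections are monotone with signs that do not depend on `v`
(`SCM.IsTMSCM.exists_mech_hasDiagonalSigns`): it is a block of the solution mapping, read along
the exogenous vectors that keep the predecessors of `i` fixed.

In a Markovian model `u i` is independent of the variables `w` preceding `i` in the common causal
order, so the joint law of `w` and `v i` is the image of a product measure under the mechanism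
(`SCM.IsMarkovian.map_observed_eq`).  Two models `M₁`, `M₂` with the same observed law therefore
have the same conditional laws `(f₁ (w, ·))_♯ μ₁ = (f₂ (w, ·))_♯ μ₂` for almost every `w`
(`ae_map_eq_of_map_prod_eq`), where `μ₁`, `μ₂` are the laws of `u i`.  For each such `w` the map
`h_w = f₂ (w, ·)⁻¹ ∘ f₁ (w, ·)` is triangular, has the same signs for all `w`, and carries `μ₁` to
`μ₂`.

The decisive point is that `h_w` does not depend on `w`, up to `μ₁`-null sets.  For two parameters
`w`, `w₀` the composite `h_{w₀}⁻¹ ∘ h_w` is triangular with increasing sections and preserves `μ₁`,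
and such a map is almost everywhere the identity (`ae_eq_self_of_measurePreserving`).  The proof of
that rigidity goes coordinate by coordinate and compares the masses of the sets `{x_j < q}` and
`{R_j x < q}`, `q` rational, inside cylinders over the preceding coordinates; it uses neither
densities nor the absence of atoms.  So `h i = h_{w₀}` for one generic `w₀` matches the mechanisms
almost everywhere (`exists_equiv_of_map_prod_eq`), and by independence the maps `h i` carry one
exogenous distribution to the other.  If `P_V` charges every nonempty open set and the mechanisms
are continuous in `v`, equality for almost every `v` is equality for all `v`.
-/

/-! ### Triangular maps with monotone sections -/

section DiagonalSigns

variable {n : ℕ} {s t : Fin n → SignType} {S T : (Fin n → ℝ) → (Fin n → ℝ)}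

/-- `T` is triangular and the section `x_j ↦ T_j (x_1, …, x_j)` is strictly increasing for all
`x_1, …, x_{j-1}` if `s j = 1`, and strictly decreasing for all of them if `s j = -1`.  Both
properties are encoded in one multiplicative identity of signs, so that composition of maps
multiplies the sign vectors. -/
def HasDiagonalSigns (s : Fin n → SignType) (T : (Fin n → ℝ) → (Fin n → ℝ)) : Prop :=
  (∀ j, s j * s j = 1) ∧
  ∀ j x y, (∀ k < j, x k = y k) →
    SignType.sign (T x j - T y j) = s j * SignType.sign (x j - y j)

namespace HasDiagonalSigns

theorem apply_eq_iff (hT : HasDiagonalSigns s T) {x y : Fin n → ℝ} {j : Fin n}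
    (h : ∀ k < j, x k = y k) : T x j = T y j ↔ x j = y j := by
  have hdec : ∀ a b : SignType, a * a = 1 → (a * b = 0 ↔ b = 0) := by decide
  rw [← sub_eq_zero, ← sign_eq_zero_iff, hT.2 j x y h, hdec _ _ (hT.1 j), sign_eq_zero_iff,
    sub_eq_zero]

theorem apply_eq_of_forall_le (hT : HasDiagonalSigns s T) {x y : Fin n → ℝ} {j : Fin n}
    (h : ∀ k ≤ j, x k = y k) : T x j = T y j :=
  (hT.apply_eq_iff fun k hk => h k hk.le).2 (h j le_rfl)

theorem agree_of_agree (hT : HasDiagonalSigns s T) {x y : Fin n → ℝ} {j : Fin n}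
    (h : ∀ k < j, T x k = T y k) : ∀ k < j, x k = y k := by
  intro k
  induction k using WellFoundedLT.induction with
  | _ k ih =>
    intro hk
    exact (hT.apply_eq_iff fun l hl => ih l hl (hl.trans hk)).1 (h k hk)

theorem injective (hT : HasDiagonalSigns s T) : Function.Injective T := by
  intro x y h
  funext j
  exact (hT.apply_eq_iff (hT.agree_of_agree fun k _ => congrFun h k)).1 (congrFun h j)

theorem comp (hS : HasDiagonalSigns s S) (hT : HasDiagonalSigns t T) :
    HasDiagonalSigns (s * t) (S ∘ T) := by
  refine ⟨fun j => ?_, fun j x y h => ?_⟩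
  · rw [Pi.mul_apply, mul_mul_mul_comm, hS.1, hT.1, one_mul]
  · have h1 : ∀ k < j, T x k = T y k := fun k hk =>
      hT.apply_eq_of_forall_le fun l hl => h l (hl.trans_lt hk)
    rw [Function.comp_apply, Function.comp_apply, hS.2 j _ _ h1, hT.2 j x y h, Pi.mul_apply,
      mul_assoc]

theorem symm {e : (Fin n → ℝ) ≃ (Fin n → ℝ)} (he : HasDiagonalSigns s e) :
    HasDiagonalSigns s e.symm := by
  refine ⟨he.1, fun j x y h => ?_⟩
  have h1 : ∀ k < j, e.symm x k = e.symm y k := by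
    apply he.agree_of_agree
    simpa using h
  have h2 := he.2 j _ _ h1
  rw [e.apply_symm_apply, e.apply_symm_apply] at h2
  rw [h2, ← mul_assoc, he.1, one_mul]

theorem lt_iff_lt (hT : HasDiagonalSigns 1 T) {x y : Fin n → ℝ} {j : Fin n}
    (h : ∀ k < j, x k = y k) : T x j < T y j ↔ x j < y j := by
  have h1 := hT.2 j x y h
  rw [Pi.one_apply, one_mul] at h1
  rw [← sub_neg, ← sign_eq_neg_one_iff, h1, sign_eq_neg_one_iff, sub_neg]

/-- A surjective triangular map with monotone sections is a Borel isomorphism; the inverse is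
measurable by the Lusin–Souslin theorem. -/
theorem exists_measurableEquiv (hT : HasDiagonalSigns s T) (hm : Measurable T)
    (hs : Function.Surjective T) : ∃ e : (Fin n → ℝ) ≃ᵐ (Fin n → ℝ), ⇑e = T := by
  have he := hm.measurableEmbedding hT.injective
  refine ⟨⟨Equiv.ofBijective T ⟨hT.injective, hs⟩, hm, ?_⟩, rfl⟩
  intro A hA
  rw [← Equiv.image_eq_preimage_symm]
  exact he.measurableSet_image.2 hA

end HasDiagonalSigns

/-- The sign vector of a triangular monotonic mapping. -/
theorem IsTMMapping.exists_hasDiagonalSigns (hT : IsTMMapping T) :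
    ∃ s, HasDiagonalSigns s T := by
  have key : ∀ j, ∃ a : SignType, a * a = 1 ∧ ∀ x y, (∀ k < j, x k = y k) →
      SignType.sign (T x j - T y j) = a * SignType.sign (x j - y j) := by
    intro j
    have hx : ∀ x y, (∀ k < j, x k = y k) → T y j = T (Function.update x j (y j)) j := by
      intro x y h
      refine hT.1 j _ _ fun k hk => ?_
      rcases hk.eq_or_lt with rfl | hk
      · simp
      · rw [Function.update_of_ne hk.ne, h k hk]
    rcases (hT.2 j).1 with hmono | hanti
    · refine ⟨1, by decide, fun x y h => ?_⟩
      rw [hx x y h, hx x x fun _ _ => rfl, one_mul]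
      rcases lt_trichotomy (x j) (y j) with hlt | heq | hgt
      · rw [sign_neg (sub_neg.2 (hmono x hlt)), sign_neg (sub_neg.2 hlt)]
      · simp [heq]
      · rw [sign_pos (sub_pos.2 (hmono x hgt)), sign_pos (sub_pos.2 hgt)]
    · refine ⟨-1, by decide, fun x y h => ?_⟩
      rw [hx x y h, hx x x fun _ _ => rfl]
      rcases lt_trichotomy (x j) (y j) with hlt | heq | hgt
      · rw [sign_pos (sub_pos.2 (hanti x hlt)), sign_neg (sub_neg.2 hlt)]
        decide
      · simp [heq]
      · rw [sign_neg (sub_neg.2 (hanti x hgt)), sign_pos (sub_pos.2 hgt)]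
        decide
  choose s hs1 hs2 using key
  exact ⟨s, hs1, hs2⟩

theorem IsTMMapping.surjective (hT : IsTMMapping T) : Function.Surjective T := by
  intro y
  -- The equation `T x = y` is solved one coordinate at a time.
  have key : ∀ m ≤ n, ∃ x, ∀ k : Fin n, (k : ℕ) < m → T x k = y k := by
    intro m
    induction m with
    | zero => exact fun _ => ⟨0, fun k hk => absurd hk (Nat.not_lt_zero _)⟩
    | succ m ih =>
      intro hm
      obtain ⟨x, hx⟩ := ih (Nat.le_of_succ_le hm)
      obtain ⟨r, hr⟩ := (hT.2 ⟨m, hm⟩).2 x (y ⟨m, hm⟩)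
      refine ⟨Function.update x ⟨m, hm⟩ r, fun k hk => ?_⟩
      rcases (Nat.lt_succ_iff.1 hk).eq_or_lt with h | h
      · obtain rfl : k = ⟨m, hm⟩ := Fin.ext h
        exact hr
      · rw [← hx k h]
        refine hT.1 k _ _ fun l hl => Function.update_of_ne ?_ _ _
        rintro rfl
        exact absurd (Fin.le_def.1 hl) (not_le.2 h)
  obtain ⟨x, hx⟩ := key n le_rfl
  exact ⟨x, funext fun k => hx k k.2⟩

end DiagonalSigns

/-! ### Rigidity of monotone triangular maps preserving a measure -/

section Rigidity

variable {n : ℕ} {μ : Measure (Fin n → ℝ)} [IsFiniteMeasure μ]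

/-- One coordinate of the rigidity statement.  For a rational `q`, only the points whose fibre
satisfies `R_j (…, q) < q` can be moved across the level `q` from the right to the left; on this
cylinder `{x_j < q}` is contained in `{R_j x < q}`, and both sets have the same mass. -/
theorem ae_le_of_measurePreserving {R : (Fin n → ℝ) → (Fin n → ℝ)}
    (hR : MeasurePreserving R μ μ) (hs : HasDiagonalSigns 1 R) (j : Fin n)
    (hj : ∀ᵐ x ∂μ, ∀ k < j, R x k = x k) : ∀ᵐ x ∂μ, x j ≤ R x j := by
  have key : ∀ q : ℚ, ∀ᵐ x ∂μ, ¬ (R x j < q ∧ (q : ℝ) ≤ x j) := by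
    intro q
    set B : Set (Fin n → ℝ) := {x | R (Function.update x j (q : ℝ)) j < q} with hB
    have hRm : Measurable fun x => R x j := (measurable_pi_apply j).comp hR.measurable
    have hBm : MeasurableSet B :=
      measurableSet_lt (hRm.comp measurable_update_left) measurable_const
    have hCm : MeasurableSet (B ∩ {x | x j < q}) :=
      hBm.inter (measurableSet_lt (measurable_pi_apply j) measurable_const)
    have hlt : ∀ x : Fin n → ℝ, R x j < R (Function.update x j (q : ℝ)) j ↔ x j < q := by
      intro x
      rw [hs.lt_iff_lt fun k hk => (Function.update_of_ne hk.ne _ _).symm, Function.update_self]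
    have hsub : B ∩ {x | x j < q} ⊆ B ∩ {x | R x j < q} := by
      rintro x ⟨hx, hxq⟩
      exact ⟨hx, ((hlt x).2 hxq).trans hx⟩
    have hpre : R ⁻¹' (B ∩ {x | x j < q}) =ᵐ[μ] (B ∩ {x | R x j < q} : Set (Fin n → ℝ)) := by
      refine Filter.eventuallyEq_set.2 ?_
      filter_upwards [hj] with x hx
      have h1 : R (Function.update (R x) j (q : ℝ)) j = R (Function.update x j (q : ℝ)) j := by
        refine hs.apply_eq_of_forall_le fun k hk => ?_
        rcases hk.eq_or_lt with rfl | hk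
        · simp
        · rw [Function.update_of_ne hk.ne, Function.update_of_ne hk.ne, hx k hk]
      simp only [Set.mem_preimage, Set.mem_inter_iff, hB, Set.mem_ofPred_eq, h1]
    have hmeas : μ (B ∩ {x | R x j < q}) = μ (B ∩ {x | x j < q}) := by
      rw [← measure_congr hpre, hR.measure_preimage hCm.nullMeasurableSet]
    have hae := ae_eq_of_subset_of_measure_ge hsub hmeas.le hCm.nullMeasurableSet
      (measure_ne_top μ _)
    filter_upwards [Filter.eventuallyEq_set.1 hae] with x hx
    rintro ⟨h1, h2⟩
    have h3 : x ∈ B := by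
      have : R (Function.update x j (q : ℝ)) j ≤ R x j := by
        rw [← not_lt, hlt x]
        exact not_lt.2 h2
      exact this.trans_lt h1
    exact absurd (hx.2 ⟨h3, h1⟩).2 (not_lt.2 h2)
  filter_upwards [ae_all_iff.2 key] with x hx
  by_contra! h
  obtain ⟨q, hq1, hq2⟩ := exists_rat_btwn h
  exact hx q ⟨hq1, hq2.le⟩

/-- A triangular map with increasing sections that preserves a finite measure is almost everywhere
the identity.  This is the uniqueness of the Knothe–Rosenblatt map, without any regularity of the
measure. -/
theorem ae_eq_self_of_measurePreserving (R : (Fin n → ℝ) ≃ᵐ (Fin n → ℝ))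
    (hR : MeasurePreserving R μ μ) (hs : HasDiagonalSigns 1 R) : ∀ᵐ x ∂μ, R x = x := by
  have key : ∀ j, ∀ᵐ x ∂μ, R x j = x j := by
    intro j
    induction j using WellFoundedLT.induction with
    | _ j ih =>
      have h1 : ∀ᵐ x ∂μ, ∀ k < j, R x k = x k :=
        ae_all_iff.2 fun k => ae_all_iff.2 fun hk => ih k hk
      have hR' : MeasurePreserving R.symm μ μ := hR.symm R
      have h2 : ∀ᵐ x ∂μ, ∀ k < j, R.symm x k = x k := by
        filter_upwards [hR'.quasiMeasurePreserving.ae h1] with x hx k hk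
        rw [← hx k hk, R.apply_symm_apply]
      have hs' : HasDiagonalSigns 1 R.symm := HasDiagonalSigns.symm (e := R.toEquiv) hs
      have h3 := hR.quasiMeasurePreserving.ae (ae_le_of_measurePreserving hR' hs' j h2)
      filter_upwards [ae_le_of_measurePreserving hR hs j h1, h3] with x hx hx'
      rw [R.symm_apply_apply] at hx'
      exact le_antisymm hx' hx
  filter_upwards [ae_all_iff.2 key] with x hx using funext hx

end Rigidity

/-! ### Matching two families of triangular transports -/

section Matching

variable {W : Type*} [MeasurableSpace W] {n : ℕ}

/-- The law of `(w, F w u)` for independent `w`, `u` determines the transported measures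
`(F w)_♯ μ` for almost every `w`, as they form a version of the conditional distribution. -/
theorem ae_map_eq_of_map_prod_eq (P : Measure W) [IsProbabilityMeasure P]
    (μ₁ μ₂ : Measure (Fin n → ℝ)) [IsProbabilityMeasure μ₁] [IsProbabilityMeasure μ₂]
    {F₁ F₂ : W → (Fin n → ℝ) → (Fin n → ℝ)}
    (hF₁ : Measurable fun p : W × (Fin n → ℝ) => F₁ p.1 p.2)
    (hF₂ : Measurable fun p : W × (Fin n → ℝ) => F₂ p.1 p.2)
    (hlaw : (P.prod μ₁).map (fun p => (p.1, F₁ p.1 p.2))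
      = (P.prod μ₂).map (fun p => (p.1, F₂ p.1 p.2))) :
    ∀ᵐ w ∂P, μ₁.map (F₁ w) = μ₂.map (F₂ w) := by
  have key : ∀ (μ : Measure (Fin n → ℝ)) [IsProbabilityMeasure μ]
      (F : W → (Fin n → ℝ) → (Fin n → ℝ)), Measurable (fun p : W × (Fin n → ℝ) => F p.1 p.2) →
      ∃ κ : Kernel W (Fin n → ℝ), IsMarkovKernel κ ∧ (∀ w, κ w = μ.map (F w)) ∧
        P ⊗ₘ κ = (P.prod μ).map (fun p => (p.1, F p.1 p.2)) := by
    intro μ _ F hF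
    have hFw : ∀ w, Measurable (F w) := fun w => hF.comp measurable_prodMk_left
    have hκ : ∀ w, ((Kernel.id ×ₖ Kernel.const W μ).map
        (fun p : W × (Fin n → ℝ) => F p.1 p.2)) w = μ.map (F w) := by
      intro w
      rw [Kernel.map_apply _ hF, Kernel.prod_apply, Kernel.id_apply, Kernel.const_apply,
        Measure.dirac_prod, Measure.map_map hF measurable_prodMk_left]
      rfl
    have hM : IsMarkovKernel ((Kernel.id ×ₖ Kernel.const W μ).map
        (fun p : W × (Fin n → ℝ) => F p.1 p.2)) := Kernel.IsMarkovKernel.map _ hF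
    refine ⟨_, hM, hκ, ?_⟩
    ext A hA
    have hG : Measurable fun p : W × (Fin n → ℝ) => (p.1, F p.1 p.2) := measurable_fst.prodMk hF
    rw [Measure.compProd_apply hA, Measure.map_apply hG hA, Measure.prod_apply (hG hA)]
    refine lintegral_congr fun w => ?_
    rw [hκ, Measure.map_apply (hFw w) (measurable_prodMk_left hA)]
    rfl
  obtain ⟨κ₁, hM₁, hκ₁, hc₁⟩ := key μ₁ F₁ hF₁
  obtain ⟨κ₂, hM₂, hκ₂, hc₂⟩ := key μ₂ F₂ hF₂
  have h := Kernel.ae_eq_of_compProd_eq (μ := P) (κ := κ₁) (η := κ₂) (by rw [hc₁, hc₂, hlaw])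
  filter_upwards [h] with w hw
  rw [← hκ₁, ← hκ₂, hw]

/-- Two families of triangular transports with fixed signs that produce the same joint law differ
by a single reparametrization `h` of the source: `h` is read off at one generic parameter `w₀`, and
rigidity shows that the choice of `w₀` does not matter. -/
theorem exists_equiv_of_map_prod_eq (P : Measure W) [IsProbabilityMeasure P]
    (μ₁ μ₂ : Measure (Fin n → ℝ)) [IsProbabilityMeasure μ₁] [IsProbabilityMeasure μ₂]
    {F₁ F₂ : W → (Fin n → ℝ) → (Fin n → ℝ)}
    (hF₁ : Measurable fun p : W × (Fin n → ℝ) => F₁ p.1 p.2)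
    (hF₂ : Measurable fun p : W × (Fin n → ℝ) => F₂ p.1 p.2)
    {s₁ s₂ : Fin n → SignType}
    (hs₁ : ∀ w, HasDiagonalSigns s₁ (F₁ w)) (hs₂ : ∀ w, HasDiagonalSigns s₂ (F₂ w))
    (hsurj₁ : ∀ w, Function.Surjective (F₁ w)) (hsurj₂ : ∀ w, Function.Surjective (F₂ w))
    (hlaw : (P.prod μ₁).map (fun p => (p.1, F₁ p.1 p.2))
      = (P.prod μ₂).map (fun p => (p.1, F₂ p.1 p.2))) :
    ∃ h : (Fin n → ℝ) ≃ᵐ (Fin n → ℝ), μ₁.map h = μ₂ ∧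
      ∀ᵐ u ∂μ₁, ∀ᵐ w ∂P, F₂ w (h u) = F₁ w u := by
  have hm₁ : ∀ w, Measurable (F₁ w) := fun w => hF₁.comp measurable_prodMk_left
  have hm₂ : ∀ w, Measurable (F₂ w) := fun w => hF₂.comp measurable_prodMk_left
  choose e₁ he₁ using fun w => (hs₁ w).exists_measurableEquiv (hm₁ w) (hsurj₁ w)
  choose e₂ he₂ using fun w => (hs₂ w).exists_measurableEquiv (hm₂ w) (hsurj₂ w)
  have hmap := ae_map_eq_of_map_prod_eq P μ₁ μ₂ hF₁ hF₂ hlaw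
  have hpush : ∀ w, μ₁.map (F₁ w) = μ₂.map (F₂ w) →
      MeasurePreserving ((e₁ w).trans (e₂ w).symm) μ₁ μ₂ := by
    intro w hw
    rw [← he₁ w, ← he₂ w] at hw
    have h1 : MeasurePreserving (e₁ w) μ₁ (μ₂.map (e₂ w)) := ⟨(e₁ w).measurable, hw⟩
    have h2 : MeasurePreserving (e₂ w) μ₂ (μ₂.map (e₂ w)) := ⟨(e₂ w).measurable, rfl⟩
    exact h1.trans (h2.symm _)
  have hsign : ∀ w, HasDiagonalSigns (s₂ * s₁) ((e₁ w).trans (e₂ w).symm) := by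
    intro w
    have h1 : HasDiagonalSigns s₁ (e₁ w).toEquiv := by
      have := hs₁ w
      rwa [← he₁ w] at this
    have h2 : HasDiagonalSigns s₂ (e₂ w).toEquiv := by
      have := hs₂ w
      rwa [← he₂ w] at this
    exact h2.symm.comp h1
  obtain ⟨w₀, hw₀⟩ := hmap.exists
  set h := (e₁ w₀).trans (e₂ w₀).symm with hh
  have hcoinc : ∀ᵐ w ∂P, ∀ᵐ u ∂μ₁, F₂ w (h u) = F₁ w u := by
    filter_upwards [hmap] with w hw
    -- The comparison map of two parameters preserves `μ₁`, and all its signs are squares.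
    have hsR : HasDiagonalSigns 1 (((e₁ w).trans (e₂ w).symm).trans h.symm) := by
      have h1 : HasDiagonalSigns (s₂ * s₁) h.toEquiv := hsign w₀
      have h2 := h1.symm.comp (hsign w)
      have h3 : s₂ * s₁ * (s₂ * s₁) = 1 := funext h1.1
      rw [h3] at h2
      exact h2
    have hR := ae_eq_self_of_measurePreserving _
      ((hpush w hw).trans ((hpush w₀ hw₀).symm _)) hsR
    filter_upwards [hR] with u hu
    have h4 : (e₂ w).symm (e₁ w u) = h u := by
      rw [← h.symm_apply_eq]
      exact hu
    rw [← h4, ← he₁ w, ← he₂ w, (e₂ w).apply_symm_apply]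
  refine ⟨h, (hpush w₀ hw₀).map_eq, (Measure.ae_ae_comm ?_).1 hcoinc⟩
  exact measurableSet_eq_fun
    (hF₂.comp (measurable_fst.prodMk (h.measurable.comp measurable_snd))) hF₁

end Matching

/-! ### Mechanisms and observed laws of triangular monotonic models -/

namespace SCM

section Causal

variable {I : Type*} {V U : I → Type*} [∀ i, MeasurableSpace (V i)] [∀ i, MeasurableSpace (U i)]

theorem mech_congr (M : SCM I V U) {i : I} {v v' : ∀ i, V i} (h : ∀ j ∈ M.pa i, v j = v' j)
    (u : U i) : M.mech i v u = M.mech i v' u := by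
  unfold mech
  congr 1
  funext j
  exact h j j.2

theorem solution_congr [Finite I] (M : SCM I V U) {o : LinearOrder I} (ho : M.IsCausalOrder o)
    {u u' : ∀ i, U i} (i : I) (h : ∀ j, o.le j i → u j = u' j) :
    M.solution u i = M.solution u' i := by
  induction i using M.wellFounded_pa.induction with
  | _ i ih =>
    rw [M.solution_eq u, M.solution_eq u', h i (o.le_refl i)]
    refine M.mech_congr (fun j hj => ih j hj fun k hk => h k ?_) _
    exact o.le_trans _ _ _ hk (@le_of_lt _ o.toPreorder _ _ (ho i j hj))

end Causal

section Extension

variable {I : Type*} {d : I → ℕ}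

/-- The extension by zero of a vector indexed by the blocks in `S`. -/
noncomputable def extendZero (S : Finset I) (w : ∀ j : S, Fin (d j) → ℝ) (j : I) :
    Fin (d j) → ℝ :=
  open Classical in if h : j ∈ S then w ⟨j, h⟩ else 0

theorem extendZero_apply (S : Finset I) (w : ∀ j : S, Fin (d j) → ℝ) {j : I} (h : j ∈ S) :
    extendZero S w j = w ⟨j, h⟩ :=
  dif_pos h

theorem measurable_extendZero (S : Finset I) :
    Measurable (extendZero S : (∀ j : S, Fin (d j) → ℝ) → ∀ j, Fin (d j) → ℝ) := by
  refine measurable_pi_lambda _ fun j => ?_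
  by_cases h : j ∈ S
  · simp only [extendZero, dif_pos h]
    exact measurable_pi_apply _
  · simp only [extendZero, dif_neg h]
    exact measurable_const

theorem mech_extendZero_restrict (M : RealSCM d) {i : I} {S : Finset I}
    (hS : ∀ j ∈ M.pa i, j ∈ S) (v : ∀ i, Fin (d i) → ℝ) (u : Fin (d i) → ℝ) :
    M.mech i (extendZero S (S.restrict v)) u = M.mech i v u :=
  M.mech_congr (fun j hj => extendZero_apply S _ (hS j hj)) u

theorem measurable_mech_extendZero (M : RealSCM d) (i : I) (S : Finset I) :
    Measurable fun p : (∀ j : S, Fin (d j) → ℝ) × (Fin (d i) → ℝ) =>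
      M.mech i (extendZero S p.1) p.2 := by
  have h1 : Measurable fun p : (∀ j : S, Fin (d j) → ℝ) × (Fin (d i) → ℝ) =>
      (fun j : M.pa i => extendZero S p.1 j) :=
    measurable_pi_lambda _ fun j =>
      (measurable_pi_iff.1 (measurable_extendZero S) j).comp measurable_fst
  exact (M.measurable_f i).comp (h1.prodMk measurable_snd)

end Extension

section Real

variable {I : Type*} [Fintype I] {d : I → ℕ}

theorem reindex_apply_vectorization (ι : (Σ i, Fin (d i)) ≃ Fin (∑ i, d i))
    (y : ∀ i, Fin (d i) → ℝ) (i : I) (j : Fin (d i)) : reindex ι y (ι ⟨i, j⟩) = y i j :=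
  congrFun (congrFun ((reindex ι).symm_apply_apply y) i) j

/-- Varying `u i` while the predecessors of `i` stay fixed turns the mechanism of `i` into a block
of the solution mapping.  Hence it inherits the triangular monotonic shape, with signs that do not
depend on the endogenous argument. -/
theorem IsTMSCM.exists_mech_hasDiagonalSigns {M : RealSCM d} (hM : M.IsTMSCM) (i : I) :
    ∃ s, ∀ v, HasDiagonalSigns s (M.mech i v) ∧ Function.Surjective (M.mech i v) := by
  classical
  obtain ⟨o, ho, ι, hι, hT⟩ := hM
  obtain ⟨s, hs⟩ := hT.exists_hasDiagonalSigns
  have hsurj : Function.Surjective M.solution := by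
    intro v
    obtain ⟨x, hx⟩ := hT.surjective (reindex ι v)
    exact ⟨(reindex ι).symm x, (reindex ι).injective hx⟩
  refine ⟨fun j => s (ι ⟨i, j⟩), fun v => ⟨⟨fun j => hs.1 _, fun j x y hxy => ?_⟩, fun y => ?_⟩⟩
  · obtain ⟨u, hu⟩ := hsurj v
    have hmech : ∀ x, M.mech i v x = M.solution (Function.update u i x) i := by
      intro x
      rw [M.solution_eq, Function.update_self]
      refine M.mech_congr (fun p hp => ?_) _
      rw [← hu]
      refine M.solution_congr ho p fun k hk => (Function.update_of_ne ?_ _ _).symm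
      rintro rfl
      exact @not_le_of_gt _ o.toPreorder _ _ (ho k p hp) hk
    have hagree : ∀ k < ι ⟨i, j⟩, reindex ι (Function.update u i x) k
        = reindex ι (Function.update u i y) k := by
      intro k hk
      obtain ⟨⟨p, l⟩, rfl⟩ := ι.surjective k
      rw [reindex_apply_vectorization, reindex_apply_vectorization]
      by_cases hp : p = i
      · subst hp
        rw [Function.update_self, Function.update_self]
        refine hxy l (Fin.lt_def.2 ?_)
        have h1 := hι.1 p l j
        have h2 := Fin.lt_def.1 hk
        omega
      · rw [Function.update_of_ne hp, Function.update_of_ne hp]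
    have h3 := hs.2 (ι ⟨i, j⟩) _ _ hagree
    simp only [Equiv.symm_apply_apply, reindex_apply_vectorization, Function.update_self] at h3
    rw [hmech, hmech]
    exact h3
  · obtain ⟨u, hu⟩ := hsurj (Function.update v i y)
    refine ⟨u i, ?_⟩
    have h1 : M.mech i v (u i) = M.mech i (Function.update v i y) (u i) := by
      refine M.mech_congr (fun j hj => (Function.update_of_ne ?_ _ _).symm) _
      rintro rfl
      exact @lt_irrefl _ o.toPreorder j (ho j j hj)
    rw [h1, ← hu, ← M.solution_eq, hu, Function.update_self]

/-- In a Markovian model `u i` is independent of the variables that precede `i`, so the joint law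
of these and of `v i` is the image of a product measure under the mechanism. -/
theorem IsMarkovian.map_observed_eq {M : RealSCM d} (hM : M.IsMarkovian) {o : LinearOrder I}
    (ho : M.IsCausalOrder o) (i : I) (S : Finset I) (hS : ∀ j, j ∈ S ↔ o.lt j i) :
    M.observed.map (fun v => (S.restrict v, v i))
      = ((M.observed.map S.restrict).prod (M.PU.map fun u => u i)).map
        (fun p => (p.1, M.mech i (extendZero S p.1) p.2)) := by
  classical
  have := M.isProbabilityMeasure_PU
  have hΓ := M.measurable_solution
  have hi : i ∉ S := fun h => @lt_irrefl _ o.toPreorder i ((hS i).1 h)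
  have hpre : ∀ u, S.restrict (M.solution (extendZero S (S.restrict u)))
      = S.restrict (M.solution u) := by
    intro u
    funext j
    refine M.solution_congr ho j fun k hk => extendZero_apply S _ ((hS k).2 ?_)
    exact @lt_of_le_of_lt _ o.toPreorder _ _ _ hk ((hS j).1 j.2)
  have hres : Measurable (S.restrict : (∀ j, Fin (d j) → ℝ) → ∀ j : S, Fin (d j) → ℝ) :=
    Finset.measurable_restrict S
  have hind : IndepFun (fun u => S.restrict (M.solution u)) (fun u => u i) M.PU := by
    have h1 := iIndepFun.indepFun_finset S {i} (Finset.disjoint_singleton_right.2 hi) hM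
      fun j => measurable_pi_apply j
    have hψ : Measurable fun r : ∀ j : ({i} : Finset I), Fin (d j) → ℝ =>
        r ⟨i, Finset.mem_singleton_self i⟩ := measurable_pi_apply _
    have h2 := h1.comp
      (φ := fun r : ∀ j : S, Fin (d j) → ℝ => S.restrict (M.solution (extendZero S r)))
      (ψ := fun r : ∀ j : ({i} : Finset I), Fin (d j) → ℝ => r ⟨i, Finset.mem_singleton_self i⟩)
      (hres.comp (hΓ.comp (measurable_extendZero S))) hψ
    have h3 : (fun u => S.restrict (M.solution u))
        = (fun r : ∀ j : S, Fin (d j) → ℝ => S.restrict (M.solution (extendZero S r)))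
          ∘ (fun u (j : S) => u j) := funext fun u => (hpre u).symm
    rw [h3]
    exact h2
  have hprod := (indepFun_iff_map_prod_eq_prod_map_map (hres.comp hΓ).aemeasurable
    (measurable_pi_apply i).aemeasurable).1 hind
  have hF := measurable_fst.prodMk (M.measurable_mech_extendZero i S)
  unfold observed
  rw [Measure.map_map (hres.prodMk (measurable_pi_apply i)) hΓ, Measure.map_map hres hΓ]
  refine Eq.trans ?_ (congrArg (Measure.map _) hprod)
  rw [Measure.map_map hF ((hres.comp hΓ).prodMk (measurable_pi_apply i))]
  congr 1
  funext u
  refine Prod.ext rfl ?_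
  change M.solution u i = M.mech i (extendZero S (S.restrict (M.solution u))) (u i)
  rw [M.mech_extendZero_restrict fun j hj => (hS j).2 (ho i j hj)]
  exact M.solution_eq u i

/-- A Borel isomorphism of the `i`-th exogenous space that matches the `i`-th mechanisms of two
models with the same observed law. -/
theorem exists_equiv_of_observed_eq {M₁ M₂ : RealSCM d} {o : LinearOrder I}
    (hT₁ : M₁.IsTMSCM) (hT₂ : M₂.IsTMSCM) (ho₁ : M₁.IsCausalOrder o) (ho₂ : M₂.IsCausalOrder o)
    (hM₁ : M₁.IsMarkovian) (hM₂ : M₂.IsMarkovian) (hobs : M₁.observed = M₂.observed) (i : I) :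
    ∃ h : (Fin (d i) → ℝ) ≃ᵐ (Fin (d i) → ℝ),
      (M₁.PU.map fun u => u i).map h = M₂.PU.map (fun u => u i) ∧
      ∀ᵐ u ∂M₁.PU, ∀ᵐ v ∂M₁.observed, M₂.mech i v (h (u i)) = M₁.mech i v (u i) := by
  classical
  have := M₁.isProbabilityMeasure_PU
  have := M₂.isProbabilityMeasure_PU
  set S : Finset I := Finset.univ.filter fun j => o.lt j i with hSdef
  have hS : ∀ j, j ∈ S ↔ o.lt j i := fun j => by simp [hSdef]
  have hres : Measurable (S.restrict : (∀ j, Fin (d j) → ℝ) → ∀ j : S, Fin (d j) → ℝ) :=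
    Finset.measurable_restrict S
  have hev : Measurable fun u : ∀ j, Fin (d j) → ℝ => u i := measurable_pi_apply i
  have : IsProbabilityMeasure M₁.observed :=
    Measure.isProbabilityMeasure_map M₁.measurable_solution.aemeasurable
  have : IsProbabilityMeasure (M₁.observed.map S.restrict) :=
    Measure.isProbabilityMeasure_map hres.aemeasurable
  have : IsProbabilityMeasure (M₁.PU.map fun u => u i) :=
    Measure.isProbabilityMeasure_map hev.aemeasurable
  have : IsProbabilityMeasure (M₂.PU.map fun u => u i) :=
    Measure.isProbabilityMeasure_map hev.aemeasurable
  obtain ⟨s₁, hs₁⟩ := hT₁.exists_mech_hasDiagonalSigns i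
  obtain ⟨s₂, hs₂⟩ := hT₂.exists_mech_hasDiagonalSigns i
  obtain ⟨h, hh, hae⟩ := exists_equiv_of_map_prod_eq (M₁.observed.map S.restrict)
    (M₁.PU.map fun u => u i) (M₂.PU.map fun u => u i)
    (M₁.measurable_mech_extendZero i S) (M₂.measurable_mech_extendZero i S)
    (fun w => (hs₁ _).1) (fun w => (hs₂ _).1) (fun w => (hs₁ _).2) (fun w => (hs₂ _).2)
    (by
      rw [← hM₁.map_observed_eq ho₁ i S hS, hobs]
      exact hM₂.map_observed_eq ho₂ i S hS)
  refine ⟨h, hh, ?_⟩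
  filter_upwards [ae_of_ae_map hev.aemeasurable hae] with u hu
  filter_upwards [ae_of_ae_map hres.aemeasurable hu] with v hv
  rwa [M₁.mech_extendZero_restrict fun j hj => (hS j).2 (ho₁ i j hj),
    M₂.mech_extendZero_restrict fun j hj => (hS j).2 (ho₂ i j hj)] at hv

theorem IsMarkovian.PU_eq_pi {M : RealSCM d} (hM : M.IsMarkovian) :
    M.PU = Measure.pi fun i => M.PU.map fun u => u i := by
  have := M.isProbabilityMeasure_PU
  have h := (iIndepFun_iff_map_fun_eq_pi_map
    fun i => (measurable_pi_apply i).aemeasurable).1 hM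
  rw [← h]
  exact Measure.map_id.symm

/-- By independence, isomorphisms of the exogenous marginals assemble to an isomorphism of the
exogenous distributions. -/
theorem IsMarkovian.map_PU_eq {M₁ M₂ : RealSCM d} (hM₁ : M₁.IsMarkovian) (hM₂ : M₂.IsMarkovian)
    (h : ∀ i, (Fin (d i) → ℝ) ≃ᵐ (Fin (d i) → ℝ))
    (hh : ∀ i, (M₁.PU.map fun u => u i).map (h i) = M₂.PU.map (fun u => u i)) :
    M₁.PU.map (fun u i => h i (u i)) = M₂.PU := by
  have := M₁.isProbabilityMeasure_PU
  have hprob : ∀ i, IsProbabilityMeasure (M₁.PU.map fun u => u i) := fun i =>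
    Measure.isProbabilityMeasure_map (measurable_pi_apply i).aemeasurable
  have hprob' : ∀ i, IsProbabilityMeasure ((M₁.PU.map fun u => u i).map (h i)) := fun i =>
    Measure.isProbabilityMeasure_map (h i).measurable.aemeasurable
  rw [hM₁.PU_eq_pi, hM₂.PU_eq_pi, Measure.pi_map_pi fun i => (h i).measurable.aemeasurable]
  exact congrArg Measure.pi (funext hh)

theorem exists_matching_equivs {o : LinearOrder I} {PV : Measure (∀ i, Fin (d i) → ℝ)}
    {M₁ M₂ : RealSCM d} (h₁ : M₁ ∈ markovTMClass d o PV) (h₂ : M₂ ∈ markovTMClass d o PV) :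
    ∃ h : ∀ i, (Fin (d i) → ℝ) ≃ᵐ (Fin (d i) → ℝ),
      M₁.PU.map (fun u i => h i (u i)) = M₂.PU ∧
      ∀ i, ∀ᵐ u ∂M₁.PU, ∀ᵐ v ∂M₁.observed, M₂.mech i v (h i (u i)) = M₁.mech i v (u i) := by
  obtain ⟨hT₁, ho₁, hM₁, hobs₁⟩ := h₁
  obtain ⟨hT₂, ho₂, hM₂, hobs₂⟩ := h₂
  choose h hh hae using
    exists_equiv_of_observed_eq hT₁ hT₂ ho₁ ho₂ hM₁ hM₂ (hobs₁.trans hobs₂.symm)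
  exact ⟨h, hM₁.map_PU_eq hM₂ h hh, hae⟩

end Real

end SCM

theorem mainTheorem2 {I : Type*} [Fintype I] (d : I → ℕ) (o : LinearOrder I)
    (PV : Measure (∀ i, Fin (d i) → ℝ)) :
    SCM.Identifiable (SCM.markovTMClass d o PV) SCM.EIEquiv ∧
    (PV.IsOpenPosMeasure →
      SCM.Identifiable {M ∈ SCM.markovTMClass d o PV | M.ContinuousInEndogenous}
        SCM.EIEquivEverywhere) := by
  refine ⟨fun M₁ h₁ M₂ h₂ => ?_, fun hPV M₁ h₁ M₂ h₂ => ?_⟩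
  · exact ⟨⟨o, h₁.2.1, h₂.2.1⟩, SCM.exists_matching_equivs h₁ h₂⟩
  · obtain ⟨h, hmap, hae⟩ := SCM.exists_matching_equivs h₁.1 h₂.1
    refine ⟨⟨o, h₁.1.2.1, h₂.1.2.1⟩, h, hmap, fun i => ?_⟩
    filter_upwards [hae i] with u hu
    -- Both sides are continuous in `v` and agree on a conull, hence dense, set.
    rw [h₁.1.2.2.2] at hu
    exact congrFun ((Continuous.ae_eq_iff_eq PV (h₂.2 i _) (h₁.2 i _)).1 hu)
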